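/- A ranked alphabet $\Sigma$ consists of finite sets $\Sigma_k$ ($k\ge 0$) of symbols of rank $k$, only finitely many of them nonempty. $T_\Sigma(S)$ denotes the set of finite trees over $\Sigma$ indexed by $S$: every $x\in S$ is such a tree, and so is $a[t_1\cdots t_k]$ for $a\in\Sigma_k$ and $t_1,\dots,t_k\in T_\Sigma(S)$ (for $k=0$ this is written $a$). Put $T_\Sigma=T_\Sigma(\emptyset)$ and $X_k=\{x_1,\dots,x_k\}$. A bottom-up finite tree transducer is a structure $M=(Q,\Sigma,\Delta,R,Q_d)$, where $Q$ is a finite set of states, $Q_d\subseteq Q$ is the set of final states, $\Sigma$ and $\Delta$ are ranked alphabets (input and output), and $R$ is a finite set of rules $a[q_1[x_1]\cdots q_k[x_k]]\to q[t]$ with $k\ge 0$, $a\in\Sigma_k$, $q_1,\dots,q_k,q\in Q$ and $t\in T_\Delta(X_k)$ (for $k=0$ the rule is $a\to q[t]$ with $t\in T_\Delta$). Write $q[u]$ for the pair consisting of a state $q$ and a tree $u\in T_\Delta$, and $Q[T_\Delta]$ for the set of these pairs. On the set of configurations $T_\Sigma(Q[T_\Delta])$, a step $\Rightarrow_M$ replaces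 a subtree of the form $a[q_1[u_1]\cdots q_k[u_k]]$ with $u_1,\dots,u_k\in T_\Delta$ by $q[t\langle x_1\leftarrow u_1,\dots,x_k\leftarrow u_k\rangle]$, for some rule $a[q_1[x_1]\cdots q_k[x_k]]\to q[t]$ in $R$. The tree transformation realized by $M$ is $$\{(s,t)\in T_\Sigma\times T_\Delta \mid s\Rightarrow_M^* q[t]\text{ for some } q\in Q_d\}.$$ $M$ is linear if in the right-hand side of each rule every variable occurs at most once; $M$ is (partial) deterministic if no two different rules have the same left-hand side. Let $B$, $LB$ and $DB$ be the classes of tree transformations realized by arbitrary, by linear, and by deterministic bottom-up finite tree transducers, respectively. For $M_1\subseteq T_\Sigma\times T_\Delta$ and $M_2\subseteq T_\Delta\times T_\Omega$ let $M_1\circ M_2=\{(s,t)\in T_\Sigma\times T_\Omega\mid (s,u)\in M_1 \text{ and } (u,t)\in M_2\text{ for some }u\in T_\Delta\}$, and for classes $F,G$ of tree transformations let $F\circ G$ be the class of all $M_1\circ M_2$ with $M_1\in F$ and $M_2\in G$. **Theorem.** 1. $LB\circ B\subseteq B$ and $LB\circ LB\subseteq LB$. 2. $B\circ DB\subseteq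 B$ and $DB\circ DB\subseteq DB$. In particular, $LB$ and $DB$ are closed under composition. -/

import Mathlib

universe u v w

namespace TreeTransducer

/-- A ranked alphabet: a finite set `sym k` of symbols of rank `k` for each `k`, nonempty for only
finitely many `k`.  (A symbol having several ranks is represented by one element for each of its
ranks; in a tree the number of direct subtrees tells which of them is meant.) -/
structure RankedAlphabet where
  sym : ℕ → Type u
  finite : Finite (Sigma sym)

/-- `IndexedTree A S` is the set `T_A(S)` of trees over the ranked alphabet `A` indexed by `S`:
an element of `S` is a tree, and so is `a[t₁ ⋯ t_k]` for a symbol `a` of rank `k ≥ 0`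
and trees `t₁, …, t_k`. -/
inductive IndexedTree (A : RankedAlphabet.{u}) (S : Type v) : Type (max u v)
  | leaf (x : S) : IndexedTree A S
  | node {k : ℕ} (a : A.sym k) (ts : Fin k → IndexedTree A S) : IndexedTree A S

namespace IndexedTree

variable {A : RankedAlphabet.{u}} {S : Type v} {S' : Type w}

/-- Simultaneous substitution of the tree `f x` for every occurrence of every index `x`. -/
def subst (f : S → IndexedTree A S') : IndexedTree A S → IndexedTree A S'
  | leaf x => f x
  | node a ts => node a fun i => subst f (ts i)

/-- The number of occurrences of the index `x` in a tree. -/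
def occ [DecidableEq S] (x : S) : IndexedTree A S → ℕ
  | leaf y => if y = x then 1 else 0
  | node _ ts => ∑ i, occ x (ts i)

/-- A tree is linear if each index occurs at most once in it. -/
def IsLinear [DecidableEq S] (t : IndexedTree A S) : Prop :=
  ∀ x : S, occ x t ≤ 1

end IndexedTree

/-- The set `T_A` of trees over `A`. -/
abbrev GroundTree (A : RankedAlphabet.{u}) : Type u := IndexedTree A Empty

/-- The set `T_A(X_k)` of trees over `A` with variables `x₁, …, x_k`. -/
abbrev VarTree (A : RankedAlphabet.{u}) (k : ℕ) : Type u := IndexedTree A (Fin k)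

/-- A rule `a[q₁[x₁] ⋯ q_k[x_k]] → q[t]` with `a` an input symbol of rank `k` and `t` in
`T_D(X_k)`.  For `k = 0` this is a rule `a → q[t]` with `t` in `T_D`. -/
structure Rule (A D : RankedAlphabet.{u}) (Q : Type u) where
  rank : ℕ
  symbol : A.sym rank
  source : Fin rank → Q
  target : Q
  output : VarTree D rank

/-- A bottom-up finite tree transducer with input alphabet `A` and output alphabet `D`. -/
structure BottomUpFTT (A D : RankedAlphabet.{u}) where
  State : Type u
  finite_state : Finite State
  rules : Set (Rule A D State)
  finite_rules : rules.Finite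
  final : Set State

namespace BottomUpFTT

variable {A D : RankedAlphabet.{u}} (M : BottomUpFTT A D)

/-- The configurations of `M`, i.e. the elements of `T_A(Q[T_D])`; the leaf `(q, t)`
stands for the tree `q[t]`. -/
abbrev Config : Type u := IndexedTree A (M.State × GroundTree D)

/-- The initial configuration of `M` on an input tree: the input tree itself. -/
def init (s : GroundTree A) : M.Config := s.subst Empty.elim

/-- One rewriting step of `M`: somewhere in the configuration an instance
`a[q₁[u₁] ⋯ q_k[u_k]]` of the left hand side of a rule, where the variables range over `T_D`,
is replaced by the corresponding instance of the right hand side. -/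
inductive Step : M.Config → M.Config → Prop
  | rule (r : Rule A D M.State) (hr : r ∈ M.rules) (u : Fin r.rank → GroundTree D) :
      Step (.node r.symbol fun i => .leaf (r.source i, u i))
        (.leaf (r.target, r.output.subst u))
  | context {k : ℕ} (a : A.sym k) (cs : Fin k → M.Config) (i : Fin k) (c : M.Config) :
      Step (cs i) c → Step (.node a cs) (.node a (Function.update cs i c))

/-- The tree transformation realized by `M`: all pairs `(s, t)` such that `s` can be rewritten,
in finitely many steps, to `q[t]` for some final state `q`. -/
def transformation : SetRel (GroundTree A) (GroundTree D) :=
  {p | ∃ q ∈ M.final, Relation.ReflTransGen M.Step (M.init p.1) (.leaf (q, p.2))}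

/-- `M` is linear if the right hand side of each rule is linear. -/
def IsLinear : Prop :=
  ∀ r ∈ M.rules, r.output.IsLinear

/-- `M` is (partial) deterministic if different rules have different left hand sides. -/
def IsDeterministic : Prop :=
  ∀ (k : ℕ) (a : A.sym k) (qs : Fin k → M.State) (q q' : M.State) (t t' : VarTree D k),
    (⟨k, a, qs, q, t⟩ : Rule A D M.State) ∈ M.rules →
    (⟨k, a, qs, q', t'⟩ : Rule A D M.State) ∈ M.rules → q = q' ∧ t = t'

end BottomUpFTT

/-- A class of tree transformations: for all ranked alphabets `A` and `D`, a set of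
subsets of `T_A × T_D`.  Inclusion of classes is the pointwise order `≤`. -/
abbrev TransformationClass : Type (u + 1) :=
  ∀ A D : RankedAlphabet.{u}, Set (SetRel (GroundTree A) (GroundTree D))

/-- The composition of classes: all `M₁ ∘ M₂ = {(s, t) | ∃ u, (s, u) ∈ M₁ ∧ (u, t) ∈ M₂}` with
`M₁` in `F` from `T_A` into `T_D` and `M₂` in `G` from `T_D` into `T_O`. -/
def TransformationClass.comp (F G : TransformationClass.{u}) : TransformationClass.{u} :=
  fun A O => {M | ∃ (D : RankedAlphabet.{u}), ∃ M₁ ∈ F A D, ∃ M₂ ∈ G D O, M = SetRel.comp M₁ M₂}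

/-- The class `B` of bottom-up tree transformations. -/
def B : TransformationClass.{u} :=
  fun A D => {T | ∃ M : BottomUpFTT A D, M.transformation = T}

/-- The class `LB` of linear bottom-up tree transformations. -/
def LB : TransformationClass.{u} :=
  fun A D => {T | ∃ M : BottomUpFTT A D, M.IsLinear ∧ M.transformation = T}

/-- The class `DB` of deterministic bottom-up tree transformations. -/
def DB : TransformationClass.{u} :=
  fun A D => {T | ∃ M : BottomUpFTT A D, M.IsDeterministic ∧ M.transformation = T}

end TreeTransducer

namespace TreeTransducer

/-! ### Substitution and occurrence counts. -/

namespace IndexedTree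

variable {A : RankedAlphabet.{u}} {S : Type v} {S' : Type w}

/-! The composition is realized by a product transducer on pairs of states: the right-hand side of a
rule of `M₁` is translated by a run of `M₂` that starts in guessed states at the variables. A run of
the product always yields runs of both machines (`Run.exists_of_product`). The converse needs one
run of `M₂` per variable, shared by all its occurrences (hypothesis `hcut` of `Run.product`). This
fails in general because of copying, where nondeterministic `M₂` may treat copies differently, and
deletion, where `M₂` may have no run on the deleted tree. Linearity of `M₁` or determinism of `M₂`
handles copying; making `M₂` total by a sink state (`totalize`) handles deletion. Everything is
proved for big-step runs, which `reflTransGen_step_iff_run` identifies with rewriting. -/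

theorem subst_subst {S'' : Type*} (t : IndexedTree A S) (f : S → IndexedTree A S')
    (g : S' → IndexedTree A S'') : (t.subst f).subst g = t.subst fun x => (f x).subst g := by
  induction t with
  | leaf x => rfl
  | node a ts ih => simp only [subst, ih]

theorem occ_subst [Fintype S] [DecidableEq S] [DecidableEq S'] (t : IndexedTree A S)
    (f : S → IndexedTree A S') (x : S') :
    (t.subst f).occ x = ∑ y, t.occ y * (f y).occ x := by
  induction t with
  | leaf y => simp [subst, occ]
  | node a ts ih =>
    simp only [subst, occ, ih, Finset.sum_mul]
    exact Finset.sum_comm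

end IndexedTree

/-! ### Big-step runs. -/

namespace BottomUpFTT

variable {A D O : RankedAlphabet.{u}}

/-- Big-step semantics: `M.Run e t q w` says that `M` can process `t`, starting from the
state and the output `e x` at each leaf `x`, and arrive in state `q` with output `w`. -/
inductive Run (M : BottomUpFTT A D) {S : Type v} {S' : Type w}
    (e : S → M.State × IndexedTree D S') :
    IndexedTree A S → M.State → IndexedTree D S' → Prop
  | leaf {x : S} {q : M.State} {w : IndexedTree D S'} (h : e x = (q, w)) : Run M e (.leaf x) q w
  | node {k : ℕ} {a : A.sym k} {qs : Fin k → M.State} {q : M.State} {t : VarTree D k}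
      {ts : Fin k → IndexedTree A S} (ws : Fin k → IndexedTree D S')
      (hr : (⟨k, a, qs, q, t⟩ : Rule A D M.State) ∈ M.rules)
      (h : ∀ i, Run M e (ts i) (qs i) (ws i)) : Run M e (.node a ts) q (t.subst ws)

/-- `M` has a rule for every left hand side. -/
def IsTotal (M : BottomUpFTT A D) : Prop :=
  ∀ (k : ℕ) (a : A.sym k) (qs : Fin k → M.State), ∃ (q : M.State) (t : VarTree D k),
    (⟨k, a, qs, q, t⟩ : Rule A D M.State) ∈ M.rules

/-- The runs of `M` on ground trees. -/
abbrev Eval (M : BottomUpFTT A D) (s : GroundTree A) (q : M.State) (t : GroundTree D) : Prop :=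
  M.Run Empty.elim s q t

section Run

variable {M : BottomUpFTT A D} {S : Type*} {S' : Type*} {S'' : Type*}

theorem Run.subst {e : S' → M.State × IndexedTree D S''} {f : S → M.State × IndexedTree D S''}
    {u : S → IndexedTree A S'} (hu : ∀ x, M.Run e (u x) (f x).1 (f x).2) {t : IndexedTree A S}
    {q : M.State} {w : IndexedTree D S''} (h : M.Run f t q w) : M.Run e (t.subst u) q w := by
  induction h with
  | @leaf x q w h =>
    have := hu x
    rwa [h] at this
  | node ws hr _ ih => exact .node ws hr ih

/-- If the runs on the substituted trees are unique, a run can be cut at these trees. -/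
theorem Run.of_subst {e : S' → M.State × IndexedTree D S''}
    {f : S → M.State × IndexedTree D S''} {u : S → IndexedTree A S'}
    (hu : ∀ x q w, M.Run e (u x) q w → f x = (q, w)) {t : IndexedTree A S}
    {q : M.State} {w : IndexedTree D S''} (h : M.Run e (t.subst u) q w) : M.Run f t q w := by
  induction t generalizing q w with
  | leaf x => exact .leaf (hu x q w h)
  | node a ts ih =>
    rw [IndexedTree.subst] at h
    cases h with
    | node ws hr h => exact .node ws hr fun i => ih i (h i)

theorem Run.congr [DecidableEq S] {e f : S → M.State × IndexedTree D S'} {t : IndexedTree A S}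
    (hef : ∀ x, t.occ x ≠ 0 → e x = f x) {q : M.State} {w : IndexedTree D S'}
    (h : M.Run e t q w) : M.Run f t q w := by
  induction h with
  | @leaf x q w h =>
    refine .leaf ?_
    rw [← hef x (by simp [IndexedTree.occ]), h]
  | @node k a qs q t ts ws hr _ ih =>
    refine .node ws hr fun i => ih i fun x hx => hef x ?_
    rw [IndexedTree.occ]
    exact fun h0 => hx (Finset.sum_eq_zero_iff.1 h0 i (Finset.mem_univ i))

/-- On a linear tree, a run can be cut at the substituted trees. -/
theorem Run.exists_of_subst_of_isLinear [DecidableEq S] {e : S' → M.State × IndexedTree D S''}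
    {u : S → IndexedTree A S'} (hu : ∀ x, ∃ q w, M.Run e (u x) q w) {t : IndexedTree A S}
    (ht : t.IsLinear) {q : M.State} {w : IndexedTree D S''} (h : M.Run e (t.subst u) q w) :
    ∃ f : S → M.State × IndexedTree D S'',
      (∀ x, M.Run e (u x) (f x).1 (f x).2) ∧ M.Run f t q w := by
  classical
  choose q₀ w₀ h₀ using hu
  induction t generalizing q w with
  | leaf x =>
    -- Only `x` occurs here; the other indices get the default runs provided by `hu`.
    refine ⟨Function.update (fun y => (q₀ y, w₀ y)) x (q, w), fun y => ?_, .leaf (by simp)⟩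
    rcases eq_or_ne y x with rfl | hy
    · simpa [IndexedTree.subst] using h
    · simpa [hy] using h₀ y
  | @node k a ts ih =>
    rw [IndexedTree.subst] at h
    cases h with
    | node ws hr h =>
      have hle : ∀ x i, (ts i).occ x ≤ (IndexedTree.node a ts).occ x := fun x i =>
        Finset.single_le_sum (f := fun i => (ts i).occ x) (fun _ _ => Nat.zero_le _)
          (Finset.mem_univ i)
      choose f hf hrun using fun i => ih i (fun x => (hle x i).trans (ht x)) (h i)
      have huniq : ∀ x i j, (ts i).occ x ≠ 0 → (ts j).occ x ≠ 0 → i = j := by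
        intro x i j hi hj
        by_contra hij
        have h1 := ht x
        have h2 : ∑ l ∈ {i, j}, (ts l).occ x ≤ ∑ l, (ts l).occ x :=
          Finset.sum_le_sum_of_subset (Finset.subset_univ _)
        rw [Finset.sum_pair hij] at h2
        rw [IndexedTree.occ] at h1
        omega
      -- By `huniq` an index occurs in at most one subtree, whose assignment is used for it; deleted
      -- indices get the default run.
      refine ⟨fun x => if hx : ∃ i, (ts i).occ x ≠ 0 then f hx.choose x else (q₀ x, w₀ x),
        fun x => ?_, .node ws hr fun i => (hrun i).congr fun x hx => ?_⟩
      · dsimp only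
        split_ifs with hx
        · exact hf _ x
        · exact h₀ x
      · have hex : ∃ i, (ts i).occ x ≠ 0 := ⟨i, hx⟩
        rw [dif_pos hex, huniq x _ _ hex.choose_spec hx]

/-- Rules inspect states but never outputs, so the outputs at the leaves can be kept symbolic. This
produces the right-hand sides of the product's rules. -/
theorem Run.exists_output {p : S → M.State} {v : S → IndexedTree D S'} {t : IndexedTree A S}
    {q : M.State} {w : IndexedTree D S'} (h : M.Run (fun x => (p x, v x)) t q w) :
    ∃ t' : IndexedTree D S, M.Run (fun x => (p x, .leaf x)) t q t' ∧ t'.subst v = w := by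
  induction h with
  | @leaf x q w h =>
    obtain ⟨rfl, rfl⟩ := Prod.mk.inj h
    exact ⟨.leaf x, .leaf rfl, rfl⟩
  | @node k a qs q t ts ws hr _ ih =>
    choose t' h1 h2 using ih
    refine ⟨t.subst t', .node t' hr h1, ?_⟩
    rw [IndexedTree.subst_subst]
    simp only [h2]

theorem Run.subst_output {p : S → M.State} {v : S → IndexedTree D S'} {t : IndexedTree A S}
    {q : M.State} {t' : IndexedTree D S} (h : M.Run (fun x => (p x, .leaf x)) t q t') :
    M.Run (fun x => (p x, v x)) t q (t'.subst v) := by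
  induction h with
  | @leaf x q w h =>
    obtain ⟨rfl, rfl⟩ := Prod.mk.inj h
    exact .leaf rfl
  | @node k a qs q t ts ws hr _ ih =>
    rw [IndexedTree.subst_subst]
    exact .node _ hr ih

theorem Run.unique (hM : M.IsDeterministic) {e : S → M.State × IndexedTree D S'}
    {t : IndexedTree A S} {q q' : M.State} {w w' : IndexedTree D S'} (h : M.Run e t q w)
    (h' : M.Run e t q' w') : q = q' ∧ w = w' := by
  induction h generalizing q' w' with
  | leaf h =>
    cases h' with
    | leaf h' => exact Prod.mk.inj (h.symm.trans h')
  | @node k a qs q t ts ws hr _ ih =>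
    cases h' with
    | @node _ _ qs' _ t' _ ws' hr' h' =>
      obtain rfl : qs = qs' := funext fun i => (ih i (h' i)).1
      obtain rfl : ws = ws' := funext fun i => (ih i (h' i)).2
      obtain ⟨rfl, rfl⟩ := hM _ _ _ _ _ _ _ hr hr'
      exact ⟨rfl, rfl⟩

theorem IsTotal.exists_run (hM : M.IsTotal) (e : S → M.State × IndexedTree D S')
    (t : IndexedTree A S) : ∃ q w, M.Run e t q w := by
  induction t with
  | leaf x => exact ⟨_, _, .leaf rfl⟩
  | node a ts ih =>
    choose qs ws h using ih
    obtain ⟨q, t, hr⟩ := hM _ a qs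
    exact ⟨q, _, .node ws hr h⟩

/-- Needed for the product to have finitely many rules. -/
theorem finite_setOf_run (M : BottomUpFTT A D) (e : S → M.State × IndexedTree D S')
    (t : IndexedTree A S) : {y : M.State × IndexedTree D S' | M.Run e t y.1 y.2}.Finite := by
  induction t with
  | leaf x =>
    refine (Set.finite_singleton (e x)).subset ?_
    rintro ⟨q, w⟩ h
    cases h with
    | leaf h => exact h.symm
  | @node k a ts ih =>
    have hfin : (⋃ r ∈ M.rules, {y : M.State × IndexedTree D S' | ∃ ws : Fin r.rank → _,
        -- The union is over rules of every rank; those of rank other than `k` contribute nothing.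
        (∃ h : r.rank = k, ∀ i, M.Run e (ts (Fin.cast h i)) (r.source i) (ws i)) ∧
          (r.target, r.output.subst ws) = y}).Finite := by
      refine M.finite_rules.biUnion fun r _ => ?_
      refine Set.Finite.image (fun ws => (r.target, r.output.subst ws)) ?_
      obtain ⟨k', a', qs, q, t⟩ := r
      by_cases hk : k' = k
      · subst hk
        refine (Set.Finite.pi' fun i => (ih i).image Prod.snd).subset ?_
        rintro ws ⟨_, h⟩ i
        exact ⟨(qs i, ws i), h i, rfl⟩
      · refine Set.finite_empty.subset ?_
        rintro ws ⟨h, _⟩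
        exact hk h
    refine hfin.subset ?_
    rintro ⟨q, w⟩ h
    cases h with
    | node ws hr h => exact Set.mem_biUnion hr ⟨ws, ⟨rfl, h⟩, rfl⟩

theorem Run.occ_le [DecidableEq S] (hM : M.IsLinear) {p : S → M.State} {t : IndexedTree A S}
    {q : M.State} {t' : IndexedTree D S} (h : M.Run (fun x => (p x, .leaf x)) t q t') (x : S) :
    t'.occ x ≤ t.occ x := by
  induction h with
  | @leaf y q w h =>
    obtain ⟨rfl, rfl⟩ := Prod.mk.inj h
    rfl
  | @node k a qs q t ts ws hr _ ih =>
    rw [IndexedTree.occ_subst, IndexedTree.occ]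
    exact Finset.sum_le_sum fun i _ =>
      (Nat.mul_le_mul (hM _ hr i) (ih i)).trans (Nat.one_mul _).le

end Run

/-! ### Rewriting agrees with big-step runs. -/

section Steps

variable {M : BottomUpFTT A D}

theorem Run.of_step {c c' : M.Config} (hc : M.Step c c') {q : M.State} {t : GroundTree D}
    (h : M.Run id c' q t) : M.Run id c q t := by
  induction hc generalizing q t with
  | rule r hr u =>
    cases h with
    | leaf h =>
      obtain ⟨rfl, rfl⟩ := Prod.mk.inj h
      exact .node u hr fun i => .leaf rfl
  | context a cs i c _ ih =>
    cases h with
    | node ws hr h =>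
      refine .node ws hr fun j => ?_
      have hj := h j
      rcases eq_or_ne j i with rfl | hne
      · rw [Function.update_self] at hj
        exact ih hj
      · rwa [Function.update_of_ne hne] at hj

theorem reflTransGen_step_update {k : ℕ} (a : A.sym k) (cs : Fin k → M.Config) (i : Fin k)
    {c : M.Config} (h : Relation.ReflTransGen M.Step (cs i) c) :
    Relation.ReflTransGen M.Step (.node a cs) (.node a (Function.update cs i c)) := by
  induction h with
  | refl => rw [Function.update_eq_self]
  | @tail b c _ hbc ih =>
    refine ih.tail ?_
    have := Step.context a (Function.update cs i b) i c (by rwa [Function.update_self])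
    rwa [Function.update_idem] at this

theorem reflTransGen_step_node {k : ℕ} (a : A.sym k) {cs ds : Fin k → M.Config}
    (h : ∀ i, Relation.ReflTransGen M.Step (cs i) (ds i)) :
    Relation.ReflTransGen M.Step (.node a cs) (.node a ds) := by
  -- The subtrees are rewritten one after another; `s` collects those already done.
  have key : ∀ s : Finset (Fin k),
      Relation.ReflTransGen M.Step (.node a cs) (.node a (s.piecewise ds cs)) := by
    intro s
    induction s using Finset.induction_on with
    | empty => rw [Finset.piecewise_empty]
    | insert i s hi ih =>
      rw [Finset.piecewise_insert]
      refine ih.trans (reflTransGen_step_update a _ i ?_)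
      rw [Finset.piecewise_eq_of_notMem _ _ _ hi]
      exact h i
  simpa using key Finset.univ

theorem Run.reflTransGen {c : M.Config} {q : M.State} {t : GroundTree D} (h : M.Run id c q t) :
    Relation.ReflTransGen M.Step c (.leaf (q, t)) := by
  induction h with
  | leaf h => rw [← h]; rfl
  | node ws hr _ ih =>
    exact (reflTransGen_step_node _ ih).tail (Step.rule _ hr ws)

theorem reflTransGen_step_iff_run {c : M.Config} {q : M.State} {t : GroundTree D} :
    Relation.ReflTransGen M.Step c (.leaf (q, t)) ↔ M.Run id c q t := by
  refine ⟨fun h => ?_, Run.reflTransGen⟩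
  induction h using Relation.ReflTransGen.head_induction_on with
  | refl => exact .leaf rfl
  | head hstep _ ih => exact ih.of_step hstep

theorem mem_transformation {s : GroundTree A} {t : GroundTree D} :
    (s, t) ∈ M.transformation ↔ ∃ q ∈ M.final, M.Eval s q t := by
  refine exists_congr fun q => and_congr_right fun _ => reflTransGen_step_iff_run.trans
    ⟨Run.of_subst fun x => x.elim, Run.subst fun x => x.elim⟩

end Steps

/-! ### Making a transducer total. -/

section Totalization

/-- The totalization of `M`: all left hand sides without a rule lead to the new state `none`
with output `t₀`. -/
def totalize (M : BottomUpFTT A D) (t₀ : GroundTree D) : BottomUpFTT A D where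
  State := Option M.State
  finite_state := have := M.finite_state; inferInstance
  rules :=
    (fun r : Rule A D M.State =>
      (⟨r.rank, r.symbol, fun i => some (r.source i), some r.target, r.output⟩ :
        Rule A D (Option M.State))) '' M.rules ∪
    {r | (∀ qs : Fin r.rank → M.State, (r.source = fun i => some (qs i)) →
        ∀ q t, (⟨r.rank, r.symbol, qs, q, t⟩ : Rule A D M.State) ∉ M.rules) ∧
      r.target = none ∧ r.output = t₀.subst Empty.elim}
  finite_rules := by
    have := M.finite_state
    have := A.finite
    refine (M.finite_rules.image _).union ?_
    refine (Set.finite_range fun p : (Σ a : Sigma A.sym, (Fin a.1 → Option M.State)) =>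
      (⟨p.1.1, p.1.2, p.2, none, t₀.subst Empty.elim⟩ : Rule A D (Option M.State))).subset ?_
    rintro ⟨k, a, qs, q, t⟩ ⟨-, h1, h2⟩
    dsimp only at h1 h2
    rw [h1, h2]
    exact ⟨⟨⟨k, a⟩, qs⟩, rfl⟩
  final := some '' M.final

variable {M : BottomUpFTT A D} {t₀ : GroundTree D}

theorem mem_totalize_rules {k : ℕ} {a : A.sym k} {qs : Fin k → Option M.State}
    {q : Option M.State} {t : VarTree D k} :
    (⟨k, a, qs, q, t⟩ : Rule A D (Option M.State)) ∈ (M.totalize t₀).rules ↔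
      (∃ qs' q', (qs = fun i => some (qs' i)) ∧ q = some q' ∧
        (⟨k, a, qs', q', t⟩ : Rule A D M.State) ∈ M.rules) ∨
      ((∀ qs' : Fin k → M.State, (qs = fun i => some (qs' i)) →
        ∀ q t, (⟨k, a, qs', q, t⟩ : Rule A D M.State) ∉ M.rules) ∧
          q = none ∧ t = t₀.subst Empty.elim) := by
  refine or_congr_left ⟨?_, ?_⟩
  · rintro ⟨⟨k', a', qs', q', t'⟩, hr, h⟩
    cases h
    exact ⟨_, _, rfl, rfl, hr⟩
  · rintro ⟨qs', q', rfl, rfl, hr⟩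
    exact ⟨_, hr, rfl⟩

theorem totalize_isTotal : (M.totalize t₀).IsTotal := by
  intro k a qs
  by_cases h : ∃ qs' : Fin k → M.State, (qs = fun i => some (qs' i)) ∧
      ∃ q t, (⟨k, a, qs', q, t⟩ : Rule A D M.State) ∈ M.rules
  · obtain ⟨qs', h, q, t, hr⟩ := h
    exact ⟨some q, t, mem_totalize_rules.2 (.inl ⟨_, _, h, rfl, hr⟩)⟩
  · push Not at h
    exact ⟨none, _, mem_totalize_rules.2 (.inr ⟨h, rfl, rfl⟩)⟩

theorem IsLinear.totalize (hM : M.IsLinear) : (M.totalize t₀).IsLinear := by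
  rintro ⟨k, a, qs, q, t⟩ hr₀
  rcases mem_totalize_rules.1 hr₀ with ⟨qs', q', rfl, rfl, hr⟩ | ⟨-, rfl, rfl⟩
  · exact hM _ hr
  · intro x
    rw [IndexedTree.occ_subst]
    simp

theorem IsDeterministic.totalize (hM : M.IsDeterministic) :
    (M.totalize t₀).IsDeterministic := by
  intro k a qs q q' t t' hr₀ hr₀'
  rcases mem_totalize_rules.1 hr₀ with ⟨ps, p, rfl, rfl, hr⟩ | ⟨h, rfl, rfl⟩ <;>
    rcases mem_totalize_rules.1 hr₀' with ⟨ps', p', hps, rfl, hr'⟩ | ⟨h', rfl, rfl⟩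
  · obtain rfl : ps = ps' := funext fun i => Option.some_injective _ (congrFun hps i)
    obtain ⟨rfl, rfl⟩ := hM _ _ _ _ _ _ _ hr hr'
    exact ⟨rfl, rfl⟩
  · exact absurd hr (h' _ rfl _ _)
  · exact absurd hr' (h _ hps _ _)
  · exact ⟨rfl, rfl⟩

/-- The state `none` is a sink: a left-hand side containing it matches only added rules, which lead
to `none` again. A run ending in an old state therefore uses old rules only. -/
theorem Run.of_totalize {s : GroundTree A} {q' : (M.totalize t₀).State} {t : GroundTree D}
    (h : (M.totalize t₀).Eval s q' t) {q : M.State} (hq : q' = some q) : M.Eval s q t := by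
  induction h generalizing q with
  | @leaf x => exact x.elim
  | node ws hr _ ih =>
    subst hq
    rcases mem_totalize_rules.1 hr with ⟨qs', p, rfl, hp, hr⟩ | ⟨-, h, -⟩
    · obtain rfl := Option.some_injective _ hp
      exact .node ws hr fun i => ih i rfl
    · exact absurd h (Option.some_ne_none q)

theorem eval_totalize {s : GroundTree A} {q : M.State} {t : GroundTree D} :
    (M.totalize t₀).Eval s (some q) t ↔ M.Eval s q t := by
  constructor
  · exact fun h => h.of_totalize rfl
  · intro h
    induction h with
    | @leaf x => exact x.elim
    | node ws hr _ ih =>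
      exact .node (M := M.totalize t₀) ws
        (mem_totalize_rules.2 (.inl ⟨_, _, rfl, rfl, hr⟩)) ih

theorem transformation_totalize : (M.totalize t₀).transformation = M.transformation := by
  ext ⟨s, t⟩
  rw [mem_transformation, mem_transformation]
  constructor
  · rintro ⟨_, ⟨q, hq, rfl⟩, h⟩
    exact ⟨q, hq, eval_totalize.1 h⟩
  · rintro ⟨q, hq, h⟩
    exact ⟨some q, ⟨q, hq, rfl⟩, eval_totalize.2 h⟩

end Totalization

/-! ### The product construction. -/

section Composition

/-- The product of two transducers: `M₂` is run on the right hand sides of the rules of `M₁`. -/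
def product (M₁ : BottomUpFTT A D) (M₂ : BottomUpFTT D O) : BottomUpFTT A O where
  State := M₁.State × M₂.State
  finite_state := have := M₁.finite_state; have := M₂.finite_state; inferInstance
  rules := {r | ∃ t : VarTree D r.rank,
    (⟨r.rank, r.symbol, fun i => (r.source i).1, r.target.1, t⟩ : Rule A D M₁.State) ∈ M₁.rules ∧
      M₂.Run (fun i => ((r.source i).2, .leaf i)) t r.target.2 r.output}
  finite_rules := by
    have := M₂.finite_state
    have hfin : (⋃ r ∈ M₁.rules, ⋃ ps : Fin r.rank → M₂.State,
        (fun y : M₂.State × VarTree O r.rank =>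
          (⟨r.rank, r.symbol, fun i => (r.source i, ps i), (r.target, y.1), y.2⟩ :
            Rule A O (M₁.State × M₂.State))) ''
          {y | M₂.Run (fun i => (ps i, .leaf i)) r.output y.1 y.2}).Finite :=
      M₁.finite_rules.biUnion fun r _ => Set.finite_iUnion fun ps =>
        (M₂.finite_setOf_run _ _).image _
    refine hfin.subset ?_
    rintro ⟨k, a, qs, q, t'⟩ ⟨t, hr, h⟩
    exact Set.mem_biUnion hr (Set.mem_iUnion.2 ⟨fun i => (qs i).2, ⟨(q.2, t'), h, rfl⟩⟩)
  final := M₁.final ×ˢ M₂.final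

variable {M₁ : BottomUpFTT A D} {M₂ : BottomUpFTT D O}

theorem Run.exists_of_product {s : GroundTree A} {q : (M₁.product M₂).State} {w : GroundTree O}
    (h : (M₁.product M₂).Eval s q w) : ∃ v, M₁.Eval s q.1 v ∧ M₂.Eval v q.2 w := by
  induction h with
  | @leaf x => exact x.elim
  | node ws hr _ ih =>
    obtain ⟨t, hr, ht⟩ := hr
    choose v h1 h2 using ih
    exact ⟨_, .node v hr h1, Run.subst h2 ht.subst_output⟩

/-- The product simulates the composition if the runs of `M₂` on instances of the right hand
sides of `M₁` can be cut at the substituted trees. -/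
theorem Run.product
    (hcut : ∀ r ∈ M₁.rules, ∀ (v : Fin r.rank → GroundTree D) (p : M₂.State) (w : GroundTree O),
      M₂.Eval (r.output.subst v) p w → ∃ f : Fin r.rank → M₂.State × GroundTree O,
        (∀ i, M₂.Eval (v i) (f i).1 (f i).2) ∧ M₂.Run f r.output p w)
    {s : GroundTree A} {q : M₁.State} {v : GroundTree D} (h : M₁.Eval s q v)
    {p : M₂.State} {w : GroundTree O} (h' : M₂.Eval v p w) :
    (M₁.product M₂).Eval s (q, p) w := by
  induction h generalizing p w with
  | @leaf x => exact x.elim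
  | @node k a qs q t ts vs hr _ ih =>
    obtain ⟨f, hf, ht⟩ := hcut _ hr vs p w h'
    -- The states of `f` are the guesses at the variables, and the symbolic output `t'` is the
    -- right-hand side of the product rule.
    obtain ⟨t', ht', rfl⟩ := Run.exists_output (p := fun i => (f i).1) (v := fun i => (f i).2) ht
    exact .node (M := M₁.product M₂) (qs := fun i => (qs i, (f i).1)) (q := (q, p))
      _ ⟨t, hr, ht'⟩ fun i => ih i (hf i)

theorem transformation_product
    (hcut : ∀ r ∈ M₁.rules, ∀ (v : Fin r.rank → GroundTree D) (p : M₂.State) (w : GroundTree O),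
      M₂.Eval (r.output.subst v) p w → ∃ f : Fin r.rank → M₂.State × GroundTree O,
        (∀ i, M₂.Eval (v i) (f i).1 (f i).2) ∧ M₂.Run f r.output p w) :
    (M₁.product M₂).transformation = SetRel.comp M₁.transformation M₂.transformation := by
  ext ⟨s, w⟩
  rw [mem_transformation, SetRel.mem_comp]
  simp only [mem_transformation]
  constructor
  · rintro ⟨⟨q, p⟩, ⟨hq, hp⟩, h⟩
    obtain ⟨v, h1, h2⟩ := h.exists_of_product
    exact ⟨v, ⟨q, hq, h1⟩, ⟨p, hp, h2⟩⟩
  · rintro ⟨v, ⟨q, hq, h1⟩, ⟨p, hp, h2⟩⟩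
    exact ⟨(q, p), ⟨hq, hp⟩, Run.product hcut h1 h2⟩

theorem transformation_product_of_isLinear (h₁ : M₁.IsLinear) (h₂ : M₂.IsTotal) :
    (M₁.product M₂).transformation = SetRel.comp M₁.transformation M₂.transformation :=
  transformation_product fun r hr v _ _ h =>
    Run.exists_of_subst_of_isLinear (fun i => h₂.exists_run _ (v i)) (h₁ r hr) h

/-- Totality gives a run on each substituted tree, even a deleted one; determinism makes it unique,
so all copies are translated alike. -/
theorem transformation_product_of_isDeterministic (h₂ : M₂.IsDeterministic)
    (h₂' : M₂.IsTotal) :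
    (M₁.product M₂).transformation = SetRel.comp M₁.transformation M₂.transformation := by
  refine transformation_product fun r hr v p w h => ?_
  choose q u hqu using fun i => h₂'.exists_run Empty.elim (v i)
  refine ⟨fun i => (q i, u i), hqu, Run.of_subst (fun i p w h => ?_) h⟩
  obtain ⟨h1, h2⟩ := (hqu i).unique h₂ h
  exact Prod.ext h1 h2

theorem IsLinear.product (h₁ : M₁.IsLinear) (h₂ : M₂.IsLinear) : (M₁.product M₂).IsLinear := by
  rintro r ⟨t, hr, ht⟩ x
  exact (ht.occ_le h₂ x).trans (h₁ _ hr x)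

/-- The first components of the source states fix the rule of `M₁`; the second components then fix
the run of `M₂` on its output. -/
theorem IsDeterministic.product (h₁ : M₁.IsDeterministic) (h₂ : M₂.IsDeterministic) :
    (M₁.product M₂).IsDeterministic := by
  rintro k a qs ⟨q, p⟩ ⟨q', p'⟩ w w' ⟨t, hr, ht⟩ ⟨t', hr', ht'⟩
  obtain ⟨h, rfl⟩ := h₁ _ _ _ _ _ _ _ hr hr'
  obtain ⟨h', hw⟩ := ht.unique h₂ ht'
  exact ⟨Prod.ext h h', hw⟩

end Composition

/-! ### The degenerate case without output trees. -/

section Empty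

/-- The transducer without states and rules. -/
def empty (A D : RankedAlphabet.{u}) : BottomUpFTT A D where
  State := PEmpty
  finite_state := inferInstance
  rules := ∅
  finite_rules := Set.finite_empty
  final := ∅

theorem isLinear_empty : (empty A D).IsLinear := fun _ h => h.elim

theorem isDeterministic_empty : (empty A D).IsDeterministic := fun _ _ _ _ _ _ _ h => h.elim

/-- Totalization requires some output tree `t₀`; if none exists, every transformation is empty and
`empty` realizes it. -/
theorem transformation_eq_of_isEmpty [IsEmpty (GroundTree D)]
    (T T' : SetRel (GroundTree A) (GroundTree D)) : T = T' :=
  Set.ext fun p => isEmptyElim p.2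

end Empty

end BottomUpFTT

/-! ### The four inclusions. -/

open BottomUpFTT

theorem LB_comp_B_le : LB.{u}.comp B.{u} ≤ B.{u} := by
  rintro A O _ ⟨D, _, ⟨M₁, h₁, rfl⟩, _, ⟨M₂, rfl⟩, rfl⟩
  rcases isEmpty_or_nonempty (GroundTree O) with _ | ⟨⟨t₀⟩⟩
  · exact ⟨empty A O, transformation_eq_of_isEmpty _ _⟩
  · rw [← transformation_totalize (M := M₂) (t₀ := t₀)]
    exact ⟨_, transformation_product_of_isLinear h₁ totalize_isTotal⟩

theorem LB_comp_LB_le : LB.{u}.comp LB.{u} ≤ LB.{u} := by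
  rintro A O _ ⟨D, _, ⟨M₁, h₁, rfl⟩, _, ⟨M₂, h₂, rfl⟩, rfl⟩
  rcases isEmpty_or_nonempty (GroundTree O) with _ | ⟨⟨t₀⟩⟩
  · exact ⟨empty A O, isLinear_empty, transformation_eq_of_isEmpty _ _⟩
  · rw [← transformation_totalize (M := M₂) (t₀ := t₀)]
    exact ⟨_, h₁.product h₂.totalize, transformation_product_of_isLinear h₁ totalize_isTotal⟩

theorem B_comp_DB_le : B.{u}.comp DB.{u} ≤ B.{u} := by
  rintro A O _ ⟨D, _, ⟨M₁, rfl⟩, _, ⟨M₂, h₂, rfl⟩, rfl⟩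
  rcases isEmpty_or_nonempty (GroundTree O) with _ | ⟨⟨t₀⟩⟩
  · exact ⟨empty A O, transformation_eq_of_isEmpty _ _⟩
  · rw [← transformation_totalize (M := M₂) (t₀ := t₀)]
    exact ⟨_, transformation_product_of_isDeterministic h₂.totalize totalize_isTotal⟩

theorem DB_comp_DB_le : DB.{u}.comp DB.{u} ≤ DB.{u} := by
  rintro A O _ ⟨D, _, ⟨M₁, h₁, rfl⟩, _, ⟨M₂, h₂, rfl⟩, rfl⟩
  rcases isEmpty_or_nonempty (GroundTree O) with _ | ⟨⟨t₀⟩⟩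
  · exact ⟨empty A O, isDeterministic_empty, transformation_eq_of_isEmpty _ _⟩
  · rw [← transformation_totalize (M := M₂) (t₀ := t₀)]
    exact ⟨_, h₁.product h₂.totalize,
      transformation_product_of_isDeterministic h₂.totalize totalize_isTotal⟩

end TreeTransducer

theorem theorem4p57 :
    (TreeTransducer.LB.{u}.comp TreeTransducer.B.{u} ≤ TreeTransducer.B.{u} ∧
      TreeTransducer.LB.{u}.comp TreeTransducer.LB.{u} ≤ TreeTransducer.LB.{u}) ∧
    (TreeTransducer.B.{u}.comp TreeTransducer.DB.{u} ≤ TreeTransducer.B.{u} ∧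
      TreeTransducer.DB.{u}.comp TreeTransducer.DB.{u} ≤ TreeTransducer.DB.{u}) := by
  exact ⟨⟨TreeTransducer.LB_comp_B_le, TreeTransducer.LB_comp_LB_le⟩,
    TreeTransducer.B_comp_DB_le, TreeTransducer.DB_comp_DB_le⟩
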